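/- Let $X$ be a complex Banach space with dual $X^*$, let $B=\{x\in X:\|x\|<1\}$, and let $D\subset B$ be dense in $B$ and balanced ($\zeta x\in D$ whenever $x\in D$, $\zeta\in\mathbb C$, $|\zeta|\le 1$). Let $\omega\in\mathbb R$ and let $h:D\to X$ be a map such that: (a) $h$ is $\omega$-pseudo-contractive: there is $\delta>0$ such that for every $\alpha\in(0,\delta)$ we have $\alpha\omega\ne 1$ and the Abel average $\Phi_\alpha=(I-\alpha h)^{-1}\circ[(1-\alpha\omega)I]$ is a well-defined holomorphic (i.e. Fréchet differentiable) map from $B$ to $D$; that is, for each $z\in B$ the equation $y-\alpha h(y)=(1-\alpha\omega)z$ has exactly one solution $y=:\Phi_\alpha(z)\in D$, and $\Phi_\alpha$ is holomorphic on $B$; (b) $h$ is closed in the weak topology: whenever $x_n\in D$ converges in norm to a point $x\in D$ and $h(x_n)$ converges weakly to some $y\in X$, then $h(x)=y$. Suppose that either $X$ is reflexive, or $X$ is weakly sequentially complete (every weakly Cauchy sequence converges weakly) and $h$ is bounded on each disc $K(x)=\{\zeta x:\zeta\in\mathbb C,\ |\zeta|<1\}$, $x\in D$. Then $h$ is $\omega$-dissipative: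 there are $\varepsilon>0$ and $\varsigma\in\mathbb R$ such that for every $x\in D$ with $1-\varepsilon<\|x\|<1$ and every $x^*\in X^*$ with $\langle x,x^*\rangle=\|x\|^2=\|x^*\|^2$, $$\operatorname{Re}\langle h(x),x^*\rangle\le\omega\|x\|^2+\varsigma\,(1-\|x\|^2).$$ -/

import Mathlib

open Filter Topology Metric Set

namespace AbelAverage

variable {X : Type*} [NormedAddCommGroup X] [NormedSpace ℂ X]

/-- The normalized duality map `J(x) = {x* ∈ X* : ‖x‖² = ⟨x, x*⟩ = ‖x*‖²}`. -/
def dualitySet (x : X) : Set (StrongDual ℂ X) :=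
  {f | f x = ((‖x‖ ^ 2 : ℝ) : ℂ) ∧ ‖f‖ ^ 2 = ‖x‖ ^ 2}

/-- `h : D → X` is `ω`-dissipative. -/
def IsDissipative (ω : ℝ) {D : Set X} (h : D → X) : Prop :=
  ∃ ε : ℝ, 0 < ε ∧ ∃ ς : ℝ, ∀ x : D, 1 - ε < ‖(x : X)‖ → ‖(x : X)‖ < 1 →
    ∀ f ∈ dualitySet (x : X),
      (f (h x)).re ≤ ω * ‖(x : X)‖ ^ 2 + ς * (1 - ‖(x : X)‖ ^ 2)

/-- `Φ` is, on the open unit ball `B`, the Abel average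
`(I - α h)⁻¹ ∘ ((1 - α ω) I)` (where `α ω ≠ 1`), as a map from `B` to `D`: for every `z ∈ B`,
the point `Φ z` lies in `D` and is the one and only solution `y ∈ D` of
`y - α h(y) = (1 - α ω) z`. Values of `Φ` outside `B` are irrelevant. -/
def IsAbelAverage (ω α : ℝ) {D : Set X} (h : D → X) (Φ : X → X) : Prop :=
  α * ω ≠ 1 ∧ MapsTo Φ (ball 0 1) D ∧
    ∀ z ∈ ball (0 : X) 1, ∀ y : D,
      (y : X) - (α : ℂ) • h y = (1 - (α : ℂ) * (ω : ℂ)) • z ↔ (y : X) = Φ z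

/-- `h : D → X` is `ω`-pseudo-contractive: for all small `α > 0` the Abel average exists on the
open unit ball `B` and belongs to `Hol(B, D)`. -/
def IsPseudoContractive (ω : ℝ) {D : Set X} (h : D → X) : Prop :=
  ∃ δ : ℝ, 0 < δ ∧ ∀ α : ℝ, 0 < α → α < δ →
    ∃ Φ : X → X, IsAbelAverage ω α h Φ ∧ DifferentiableOn ℂ Φ (ball 0 1)

/-- `h : D → X` is closed in the weak topology: norm convergence `xₙ → x` within `D` together with
weak convergence `h(xₙ) → y` in `X` imply `h(x) = y`. -/
def IsWeaklyClosedMap {D : Set X} (h : D → X) : Prop :=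
  ∀ (u : ℕ → D) (x : D) (y : X),
    Tendsto (fun n => (u n : X)) atTop (𝓝 (x : X)) →
    Tendsto (fun n => toWeakSpace ℂ X (h (u n))) atTop (𝓝 (toWeakSpace ℂ X y)) →
    h x = y

variable (X) in
/-- Reflexivity: the canonical embedding into the bidual is onto. -/
def IsReflexiveSpace : Prop :=
  Function.Surjective (NormedSpace.inclusionInDoubleDual ℂ X)

variable (X) in
/-- Weak sequential completeness: every weakly Cauchy sequence converges weakly. -/
def IsWeaklySeqComplete : Prop :=
  ∀ u : ℕ → X, (∀ f : StrongDual ℂ X, CauchySeq (fun n => f (u n))) →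
    ∃ x : X, Tendsto (fun n => toWeakSpace ℂ X (u n)) atTop (𝓝 (toWeakSpace ℂ X x))

/-- The disc `K(x) = {ζ x : |ζ| < 1}`. -/
def disc (x : X) : Set X := {y | ∃ ζ : ℂ, ‖ζ‖ < 1 ∧ y = ζ • x}

/-- `h : D → X` is bounded on every disc `K(x)`, `x ∈ D`. -/
def IsBoundedOnDiscs {D : Set X} (h : D → X) : Prop :=
  ∀ x : D, ∃ C : ℝ, ∀ y : D, (y : X) ∈ disc (x : X) → ‖h y‖ ≤ C

end AbelAverage

/-! Solving the Abel equation backwards, `Φ α` sends `x + t v` to `x`, where `v = h x - ω x` and `t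
= -α / (1 - α ω)` tends to 0. A Schwarz-type Lipschitz bound and density give `Φ α → id` pointwise
on the ball. On the complex line `x + ζ v`, the maps `G ζ = Φ α (x + ζ v) - (x + ζ v)` are bounded
and tend to 0, hence so do their difference quotients (`tendsto_dslope_zero`). Since `G t = -t v`
and `-t / α → 1`, `(Φ α x - x) / α` converges in norm to `v`. Dividing the Schwarz–Pick bound on `‖Φ
α x‖ - ‖x‖` by `α` and letting `α → 0⁺` gives dissipativity. -/

namespace AbelAverage

/-! ### Schwarz–Pick estimates -/

/-- The scalar **Schwarz–Pick inequality** between `0` and `z`. -/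
theorem norm_sub_norm_le_of_mapsTo_unitDisc {φ : ℂ → ℂ} (hd : DifferentiableOn ℂ φ (ball 0 1))
    (hm : MapsTo φ (ball 0 1) (ball 0 1)) {z : ℂ} (hz : ‖z‖ < 1) :
    ‖φ z‖ - ‖z‖ ≤ ‖φ 0‖ * (1 - ‖z‖ ^ 2) := by
  have hlt : ∀ w ∈ ball (0 : ℂ) 1, ‖φ w‖ < 1 := fun w hw => by simpa using hm hw
  have hb : ‖φ 0‖ < 1 := hlt 0 (by simp)
  have key : ∀ w : ℂ, ‖1 - (starRingEnd ℂ) (φ 0) * w‖ ^ 2 - ‖w - φ 0‖ ^ 2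
      = (1 - ‖w‖ ^ 2) * (1 - ‖φ 0‖ ^ 2) := by
    intro w
    simp only [← Complex.normSq_eq_norm_sq, Complex.normSq_apply, Complex.sub_re, Complex.sub_im,
      Complex.mul_re, Complex.mul_im, Complex.conj_re, Complex.conj_im, Complex.one_re,
      Complex.one_im]
    ring
  have hlow : ∀ w : ℂ, 1 - ‖φ 0‖ * ‖w‖ ≤ ‖1 - (starRingEnd ℂ) (φ 0) * w‖ := by
    intro w
    have := norm_sub_norm_le (1 : ℂ) ((starRingEnd ℂ) (φ 0) * w)
    simpa using this
  have hpos : ∀ w ∈ ball (0 : ℂ) 1, 0 < ‖1 - (starRingEnd ℂ) (φ 0) * φ w‖ := by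
    intro w hw
    have := hlow (φ w)
    have := hlt w hw
    nlinarith [norm_nonneg (φ 0), norm_nonneg (φ w)]
  -- Composing with the Möbius map that sends `φ 0` to 0 makes the Schwarz lemma applicable.
  have hψ : DifferentiableOn ℂ
      (fun w => (φ w - φ 0) / (1 - (starRingEnd ℂ) (φ 0) * φ w)) (ball 0 1) :=
    (hd.sub_const _).div ((hd.const_mul _).const_sub _) fun w hw => norm_pos_iff.1 (hpos w hw)
  have hψm : MapsTo (fun w => (φ w - φ 0) / (1 - (starRingEnd ℂ) (φ 0) * φ w)) (ball 0 1)
      (closedBall 0 1) := by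
    intro w hw
    rw [mem_closedBall_zero_iff, norm_div, div_le_one (hpos w hw)]
    refine le_of_sq_le_sq ?_ (hpos w hw).le
    have h1 := key (φ w)
    have h2 : 0 ≤ (1 - ‖φ w‖ ^ 2) * (1 - ‖φ 0‖ ^ 2) := by
      refine mul_nonneg ?_ ?_
      · have := hlt w hw; nlinarith [norm_nonneg (φ w)]
      · nlinarith [norm_nonneg (φ 0)]
    linarith
  have hz' : z ∈ ball (0 : ℂ) 1 := by simpa using hz
  have hs := Complex.norm_le_norm_of_mapsTo_ball hψ hψm (by simp) hz
  rw [norm_div, div_le_iff₀ (hpos z hz')] at hs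
  have hk := key (φ z)
  have hl := hlow (φ z)
  have hp := hlt z hz'
  generalize ‖1 - (starRingEnd ℂ) (φ 0) * φ z‖ = m at *
  have hs0 := norm_nonneg (φ z - φ 0)
  generalize ‖φ z - φ 0‖ = s at *
  have hp0 := norm_nonneg (φ z)
  have hb0 := norm_nonneg (φ 0)
  have hr0 := norm_nonneg z
  generalize ‖φ z‖ = p at *
  generalize ‖φ 0‖ = b at *
  generalize ‖z‖ = r at *
  have h0 : 0 ≤ 1 - b * p := by nlinarith
  have hm0 : (1 - b * p) ^ 2 ≤ m ^ 2 := pow_le_pow_left₀ h0 hl 2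
  have hr1 : 0 ≤ 1 - r ^ 2 := by nlinarith
  have hs1 : s ^ 2 ≤ (r * m) ^ 2 := pow_le_pow_left₀ hs0 hs 2
  -- Both `m² - s²` and `(1 - bp)² - (p - b)²` equal `(1 - p²)(1 - b²)`, so the bound passes to the
  -- moduli.
  have h1 : (p - b) ^ 2 ≤ (r * (1 - b * p)) ^ 2 := by
    nlinarith [mul_le_mul_of_nonneg_left hm0 hr1]
  have h2 : p - b ≤ r * (1 - b * p) := le_of_sq_le_sq h1 (mul_nonneg hr0 h0)
  rcases le_total p r with hpr | hpr
  · have := mul_nonneg hb0 hr1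
    linarith
  · have := mul_le_mul_of_nonneg_left hpr (mul_nonneg hb0 hr0)
    nlinarith

/-- The **Schwarz–Pick inequality** for holomorphic self-maps of the unit ball of a complex normed
space. -/
theorem norm_sub_norm_le_of_mapsTo_unitBall {E : Type*} [NormedAddCommGroup E] [NormedSpace ℂ E]
    {Φ : E → E} (hd : DifferentiableOn ℂ Φ (ball 0 1)) (hm : MapsTo Φ (ball 0 1) (ball 0 1))
    {z : E} (hz : ‖z‖ < 1) : ‖Φ z‖ - ‖z‖ ≤ ‖Φ 0‖ * (1 - ‖z‖ ^ 2) := by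
  rcases eq_or_ne z 0 with rfl | hz0
  · simp
  obtain ⟨g, hg, hgz⟩ := exists_dual_vector'' ℂ (Φ z)
  have hzn : ‖z‖ ≠ 0 := norm_ne_zero_iff.2 hz0
  set u : E := ((‖z‖⁻¹ : ℝ) : ℂ) • z with hu
  have hun : ‖u‖ = 1 := by
    rw [hu, norm_smul, Complex.norm_real, norm_inv, norm_norm, inv_mul_cancel₀ hzn]
  have hmaps : MapsTo (fun ζ : ℂ => ζ • u) (ball 0 1) (ball (0 : E) 1) := by
    intro ζ hζ
    simpa [norm_smul, hun] using hζ
  have hgle : ∀ y, ‖g y‖ ≤ ‖y‖ := fun y => by simpa using g.le_of_opNorm_le hg y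
  have hφ : DifferentiableOn ℂ (fun ζ : ℂ => g (Φ (ζ • u))) (ball 0 1) :=
    g.differentiable.comp_differentiableOn
      (hd.comp (differentiable_id.smul_const u).differentiableOn hmaps)
  have hφm : MapsTo (fun ζ : ℂ => g (Φ (ζ • u))) (ball 0 1) (ball 0 1) := by
    intro ζ hζ
    have := hm (hmaps hζ)
    rw [mem_ball_zero_iff] at this ⊢
    exact (hgle _).trans_lt this
  have key := norm_sub_norm_le_of_mapsTo_unitDisc hφ hφm (z := (‖z‖ : ℂ)) (by simpa using hz)
  have huz : (‖z‖ : ℂ) • u = z := by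
    rw [hu, smul_smul, ← Complex.ofReal_mul, mul_inv_cancel₀ hzn, Complex.ofReal_one, one_smul]
  simp only [huz, hgz, zero_smul, Complex.norm_real, norm_norm, RCLike.norm_ofReal,
    abs_norm] at key
  refine key.trans (mul_le_mul_of_nonneg_right (hgle _) ?_)
  nlinarith [norm_nonneg z]

/-- A uniform local Lipschitz bound for holomorphic self-maps of the unit ball. -/
theorem norm_sub_le_of_mapsTo_unitBall {E : Type*} [NormedAddCommGroup E] [NormedSpace ℂ E]
    {Φ : E → E} (hd : DifferentiableOn ℂ Φ (ball 0 1)) (hm : MapsTo Φ (ball 0 1) (ball 0 1))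
    {y z : E} (hy : ‖y‖ < 1) (hz : ‖z - y‖ < 1 - ‖y‖) :
    ‖Φ z - Φ y‖ ≤ 2 / (1 - ‖y‖) * ‖z - y‖ := by
  have hsub : ball y (1 - ‖y‖) ⊆ ball (0 : E) 1 := ball_subset_ball' (by simp)
  have := Complex.dist_le_div_mul_dist_of_mapsTo_ball (R₂ := 2) (hd.mono hsub) (fun w hw => by
    have h1 := hm (hsub hw)
    have h2 := hm (show y ∈ ball (0 : E) 1 by simpa using hy)
    rw [mem_ball_zero_iff] at h1 h2
    rw [mem_closedBall, dist_eq_norm_sub]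
    linarith [norm_sub_le (Φ w) (Φ y)]) (show z ∈ ball y (1 - ‖y‖) by
      rwa [mem_ball, dist_eq_norm_sub])
  simpa only [dist_eq_norm_sub] using this

/-! ### Convergence of holomorphic families -/

/-- Pointwise convergence to `0` of a uniformly bounded family of holomorphic functions on a disc
implies convergence of the difference quotients at the centre along points tending to it. -/
theorem tendsto_dslope_zero {ι E : Type*} [NormedAddCommGroup E] [NormedSpace ℂ E]
    [CompleteSpace E] {l : Filter ι} {G : ι → ℂ → E} {t : ι → ℂ} {r M : ℝ} (hr : 0 < r)
    (hd : ∀ᶠ i in l, DifferentiableOn ℂ (G i) (ball 0 r))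
    (hM : ∀ᶠ i in l, ∀ ζ ∈ ball (0 : ℂ) r, ‖G i ζ‖ ≤ M)
    (hG : ∀ ζ ∈ ball (0 : ℂ) r, Tendsto (fun i => G i ζ) l (𝓝 0)) (ht : Tendsto t l (𝓝 0)) :
    Tendsto (fun i => dslope (G i) 0 (t i)) l (𝓝 0) := by
  obtain ⟨C, hC0, hC⟩ : ∃ C : ℝ, 0 < C ∧ ∀ᶠ i in l, ∀ ζ ∈ ball (0 : ℂ) r,
      ‖dslope (G i) 0 ζ - dslope (G i) 0 0‖ ≤ C * ‖ζ‖ := by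
    -- The Schwarz bound is used twice, on `G i` and then on its `dslope`; the absolute value and `+
    -- 1` only force positivity.
    refine ⟨|2 * (2 * M / r) / r| + 1, by positivity, ?_⟩
    filter_upwards [hd, hM] with i hdi hMi ζ hζ
    have h0 : (0 : ℂ) ∈ ball (0 : ℂ) r := mem_ball_self hr
    have hb : ∀ w ∈ ball (0 : ℂ) r, ‖dslope (G i) 0 w‖ ≤ 2 * M / r := fun w hw =>
      Complex.norm_dslope_le_div_of_mapsTo_ball hdi (fun w hw => by
        rw [mem_closedBall, dist_eq_norm_sub]
        linarith [norm_sub_le (G i w) (G i 0), hMi w hw, hMi 0 h0]) hw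
    have := Complex.dist_le_div_mul_dist_of_mapsTo_ball (R₂ := 2 * (2 * M / r))
      ((Complex.differentiableOn_dslope (ball_mem_nhds (0 : ℂ) hr)).2 hdi) (fun w hw => by
        rw [mem_closedBall, dist_eq_norm_sub]
        linarith [norm_sub_le (dslope (G i) 0 w) (dslope (G i) 0 0), hb w hw, hb 0 h0]) hζ
    rw [dist_eq_norm_sub, dist_zero_right] at this
    refine this.trans (mul_le_mul_of_nonneg_right ?_ (norm_nonneg _))
    linarith [le_abs_self (2 * (2 * M / r) / r)]
  rw [Metric.tendsto_nhds]
  intro ε hε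
  -- At the fixed nonzero `s` the quotient tends to 0; the uniform Lipschitz bound carries this
  -- through 0 to the moving point `t i`.
  obtain ⟨s, hs0, hs⟩ := exists_between (lt_min hr (show 0 < ε / (3 * C) by positivity))
  obtain ⟨hsr, hsε⟩ := lt_min_iff.1 hs
  have hsC : C * s < ε / 3 := by
    rw [lt_div_iff₀ (by positivity)] at hsε
    linarith
  have hsn : ‖(s : ℂ)‖ = s := by rw [Complex.norm_real, Real.norm_of_nonneg hs0.le]
  have hsne : (s : ℂ) ≠ 0 := Complex.ofReal_ne_zero.2 hs0.ne'
  have hsmem : (s : ℂ) ∈ ball (0 : ℂ) r := by rwa [mem_ball_zero_iff, hsn]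
  have hslope : Tendsto (fun i => dslope (G i) 0 (s : ℂ)) l (𝓝 0) := by
    have := ((hG s hsmem).sub (hG 0 (mem_ball_self hr))).const_smul ((s : ℂ)⁻¹)
    simpa [dslope_of_ne _ hsne, slope_def_module] using this
  filter_upwards [hC, Metric.tendsto_nhds.1 hslope (ε / 3) (by positivity),
    Metric.tendsto_nhds.1 ht s hs0] with i hi hi1 hi2
  rw [dist_zero_right] at hi1 hi2 ⊢
  have e1 := hi s hsmem
  have e2 := hi (t i) (by rw [mem_ball_zero_iff]; linarith)
  rw [hsn] at e1
  have e3 : C * ‖t i‖ ≤ C * s := by gcongr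
  have e4 : dslope (G i) 0 (t i) = (dslope (G i) 0 (t i) - dslope (G i) 0 0)
      - (dslope (G i) 0 (s : ℂ) - dslope (G i) 0 0) + dslope (G i) 0 (s : ℂ) := by abel
  rw [e4]
  have e5 := norm_add_le ((dslope (G i) 0 (t i) - dslope (G i) 0 0)
      - (dslope (G i) 0 (s : ℂ) - dslope (G i) 0 0)) (dslope (G i) 0 (s : ℂ))
  have e6 := norm_sub_le (dslope (G i) 0 (t i) - dslope (G i) 0 0)
      (dslope (G i) 0 (s : ℂ) - dslope (G i) 0 0)
  linarith

/-- If holomorphic self-maps `Φ i` of the unit ball satisfy `Φ i (z i) = x` with `z i → x`, then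
`Φ i x → x`. -/
theorem tendsto_of_apply_eq {ι E : Type*} [NormedAddCommGroup E] [NormedSpace ℂ E]
    {l : Filter ι} {Φ : ι → E → E} (hd : ∀ᶠ i in l, DifferentiableOn ℂ (Φ i) (ball 0 1))
    (hm : ∀ᶠ i in l, MapsTo (Φ i) (ball 0 1) (ball 0 1)) {x : E} (hx : ‖x‖ < 1) {z : ι → E}
    (hz : Tendsto z l (𝓝 x)) (hΦ : ∀ᶠ i in l, Φ i (z i) = x) :
    Tendsto (fun i => Φ i x) l (𝓝 x) := by
  have hzx : Tendsto (fun i => ‖z i - x‖) l (𝓝 0) := tendsto_iff_norm_sub_tendsto_zero.1 hz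
  rw [tendsto_iff_norm_sub_tendsto_zero]
  refine squeeze_zero' (Eventually.of_forall fun _ => norm_nonneg _) ?_
    (by simpa using hzx.const_mul (2 / (1 - ‖x‖)))
  filter_upwards [hd, hm, hΦ, hzx.eventually_lt_const (sub_pos.2 hx)] with i h1 h2 h3 h4
  have := norm_sub_le_of_mapsTo_unitBall h1 h2 hx h4
  rwa [h3, norm_sub_rev] at this

/-- Pointwise convergence to the identity on a dense subset extends to the whole unit ball, for
holomorphic self-maps of the ball. -/
theorem tendsto_self_of_dense {ι E : Type*} [NormedAddCommGroup E] [NormedSpace ℂ E]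
    {l : Filter ι} {Φ : ι → E → E} (hd : ∀ᶠ i in l, DifferentiableOn ℂ (Φ i) (ball 0 1))
    (hm : ∀ᶠ i in l, MapsTo (Φ i) (ball 0 1) (ball 0 1)) {D : Set E}
    (hD : ball (0 : E) 1 ⊆ closure D) (hΦ : ∀ x ∈ D, Tendsto (fun i => Φ i x) l (𝓝 x))
    {y : E} (hy : ‖y‖ < 1) : Tendsto (fun i => Φ i y) l (𝓝 y) := by
  rw [Metric.tendsto_nhds]
  intro ε hε
  have hy' : 0 < 1 - ‖y‖ := sub_pos.2 hy
  set L := 2 / (1 - ‖y‖) with hL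
  have hL0 : 0 < L := by positivity
  obtain ⟨x, hxD, hxy⟩ := Metric.mem_closure_iff.1 (hD (by simpa using hy))
    (min (1 - ‖y‖) (ε / (2 * (L + 1)))) (lt_min hy' (by positivity))
  obtain ⟨hx1, hx2⟩ := lt_min_iff.1 hxy
  rw [dist_comm, dist_eq_norm_sub] at hx1 hx2
  rw [lt_div_iff₀ (by positivity)] at hx2
  filter_upwards [hd, hm, Metric.tendsto_nhds.1 (hΦ x hxD) (ε / 2) (by positivity)]
    with i h1 h2 h3
  have h4 := norm_sub_le_of_mapsTo_unitBall h1 h2 hy hx1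
  rw [← hL] at h4
  have h5 := dist_triangle4 (Φ i y) (Φ i x) x y
  rw [dist_comm (Φ i y) (Φ i x), dist_eq_norm_sub (Φ i x) (Φ i y), dist_eq_norm_sub x y] at h5
  linarith

/-! ### Abel averages -/

section

variable {X : Type*} [NormedAddCommGroup X] [NormedSpace ℂ X] {D : Set X} {ω : ℝ} {h : D → X}

/-- The Abel average maps `(1 - αω)⁻¹ (x - α h(x))` to `x`. The preimage is written as the
perturbation `x + t (h(x) - ω x)` with `t = -α / (1 - αω)`. -/
theorem IsAbelAverage.apply_add_smul {α : ℝ} {Φ : X → X} (hΦ : IsAbelAverage ω α h Φ) (x : D)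
    (hz : (x : X) + ((-(α / (1 - α * ω)) : ℝ) : ℂ) • (h x - (ω : ℂ) • (x : X)) ∈ ball (0 : X) 1) :
    Φ ((x : X) + ((-(α / (1 - α * ω)) : ℝ) : ℂ) • (h x - (ω : ℂ) • (x : X))) = x := by
  refine ((hΦ.2.2 _ hz x).1 ?_).symm
  have hne : (1 - (α : ℂ) * (ω : ℂ)) ≠ 0 := by
    rw [sub_ne_zero]
    exact_mod_cast hΦ.1.symm
  have h1 : (1 - (α : ℂ) * (ω : ℂ)) * ((-(α / (1 - α * ω)) : ℝ) : ℂ) = -α := by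
    push_cast
    field_simp
  rw [smul_add, smul_smul, h1]
  module

/-- The Abel average at `z` satisfies `Φ(z) - z = α (h(Φ(z)) - ω z)`; in the limit `α → 0⁺` the
quotients `(Φ(x) - x) / α` converge in norm to `h(x) - ω x` at every `x ∈ D`. -/
theorem tendsto_inv_smul_sub [CompleteSpace X] (hDB : D ⊆ ball (0 : X) 1)
    (hD : ball (0 : X) 1 ⊆ closure D) {Φ : ℝ → X → X}
    (hA : ∀ᶠ α in 𝓝[>] (0 : ℝ), IsAbelAverage ω α h (Φ α))
    (hd : ∀ᶠ α in 𝓝[>] (0 : ℝ), DifferentiableOn ℂ (Φ α) (ball 0 1)) (x : D) :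
    Tendsto (fun α : ℝ => ((α⁻¹ : ℝ) : ℂ) • (Φ α x - x)) (𝓝[>] 0)
      (𝓝 (h x - (ω : ℂ) • (x : X))) := by
  have hm : ∀ᶠ α in 𝓝[>] (0 : ℝ), MapsTo (Φ α) (ball 0 1) (ball 0 1) :=
    hA.mono fun α hα => hα.2.1.mono_right hDB
  have hnorm : ∀ x : D, ‖(x : X)‖ < 1 := fun x => by simpa using hDB x.2
  set t : ℝ → ℂ := fun α => ((-(α / (1 - α * ω)) : ℝ) : ℂ) with ht_def
  have hden : Tendsto (fun α : ℝ => (1 - α * ω)⁻¹) (𝓝[>] 0) (𝓝 1) := by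
    have : ContinuousAt (fun α : ℝ => (1 - α * ω)⁻¹) 0 :=
      ContinuousAt.inv₀ (by fun_prop) (by simp)
    simpa [ContinuousAt] using this.tendsto.mono_left nhdsWithin_le_nhds
  have hid : Tendsto (fun α : ℝ => α) (𝓝[>] 0) (𝓝 0) := tendsto_id.mono_left nhdsWithin_le_nhds
  have ht : Tendsto t (𝓝[>] 0) (𝓝 0) := by
    have := (Complex.continuous_ofReal.tendsto _).comp (hid.mul hden).neg
    simpa [ht_def, Function.comp_def, div_eq_mul_inv] using this
  have hz : ∀ x : D, Tendsto (fun α => (x : X) + t α • (h x - (ω : ℂ) • (x : X))) (𝓝[>] 0)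
      (𝓝 (x : X)) := fun x => by
    simpa using (ht.smul_const (h x - (ω : ℂ) • (x : X))).const_add (x : X)
  have hzΦ : ∀ x : D, ∀ᶠ α in 𝓝[>] (0 : ℝ),
      Φ α ((x : X) + t α • (h x - (ω : ℂ) • (x : X))) = x := fun x => by
    filter_upwards [hA, (hz x).eventually_mem (isOpen_ball.mem_nhds (hDB x.2))] with α h1 h2
    exact h1.apply_add_smul x h2
  have hconv : ∀ y : X, ‖y‖ < 1 → Tendsto (fun α => Φ α y) (𝓝[>] 0) (𝓝 y) := fun y hy =>
    tendsto_self_of_dense hd hm hD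
      (fun x hx => tendsto_of_apply_eq hd hm (hnorm ⟨x, hx⟩) (hz ⟨x, hx⟩) (hzΦ ⟨x, hx⟩)) hy
  set v : X := h x - (ω : ℂ) • (x : X) with hv
  set r : ℝ := (1 - ‖(x : X)‖) / (‖v‖ + 1) with hr_def
  have hr : 0 < r := div_pos (sub_pos.2 (hnorm x)) (by positivity)
  have hline : MapsTo (fun ζ : ℂ => (x : X) + ζ • v) (ball 0 r) (ball (0 : X) 1) := by
    intro ζ hζ
    rw [mem_ball_zero_iff, hr_def, lt_div_iff₀ (by positivity)] at hζ
    rw [mem_ball_zero_iff]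
    have := norm_add_le (x : X) (ζ • v)
    rw [norm_smul] at this
    nlinarith [norm_nonneg ζ]
  have hlined : Differentiable ℂ (fun ζ : ℂ => (x : X) + ζ • v) := by fun_prop
  have hslope := tendsto_dslope_zero (M := 2) (t := t)
    (G := fun α ζ => Φ α ((x : X) + ζ • v) - ((x : X) + ζ • v)) hr
    (hd.mono fun α hα => (hα.comp hlined.differentiableOn hline).sub hlined.differentiableOn)
    (hm.mono fun α hα ζ hζ => by
      have h1 := hline hζ
      have h2 := hα h1
      rw [mem_ball_zero_iff] at h1 h2
      linarith [norm_sub_le (Φ α ((x : X) + ζ • v)) ((x : X) + ζ • v)])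
    (fun ζ hζ => tendsto_sub_nhds_zero_iff.2 (hconv _ (by simpa using hline hζ))) ht
  have hlim := ((Complex.continuous_ofReal.tendsto _).comp hden).smul (hslope.const_add v)
  rw [add_zero, Complex.ofReal_one, one_smul] at hlim
  refine hlim.congr' ?_
  filter_upwards [hzΦ x, self_mem_nhdsWithin] with α h1 (hα : 0 < α)
  have h2 := sub_smul_dslope (fun ζ : ℂ => Φ α ((x : X) + ζ • v) - ((x : X) + ζ • v)) 0 (t α)
  simp only [← hv] at h1
  simp only [h1, zero_smul, add_zero, sub_zero] at h2
  have h3 : Φ α x - x = (-t α) • (v + dslope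
      (fun ζ : ℂ => Φ α ((x : X) + ζ • v) - ((x : X) + ζ • v)) 0 (t α)) := by
    rw [neg_smul, smul_add, h2]
    abel
  rw [h3, smul_smul, Function.comp_apply]
  congr 1
  have : (α : ℂ) ≠ 0 := Complex.ofReal_ne_zero.2 hα.ne'
  simp only [ht_def]
  push_cast
  field_simp

/-- An `ω`-pseudo-contractive map is `ω`-dissipative, with `ς = ‖h 0‖`, on the whole of `D`. -/
theorem IsPseudoContractive.isDissipative [CompleteSpace X] (hDB : D ⊆ ball (0 : X) 1)
    (hD : ball (0 : X) 1 ⊆ closure D) (h0 : (0 : X) ∈ D) (hpc : IsPseudoContractive ω h) :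
    IsDissipative ω h := by
  obtain ⟨δ, hδ, hex⟩ := hpc
  choose! Φ hA hd using hex
  have hev : ∀ᶠ α in 𝓝[>] (0 : ℝ), 0 < α ∧ α < δ := Ioo_mem_nhdsGT hδ
  have hlim := tendsto_inv_smul_sub hDB hD (hev.mono fun α hα => hA α hα.1 hα.2)
    (hev.mono fun α hα => hd α hα.1 hα.2)
  refine ⟨1, one_pos, ‖h ⟨0, h0⟩‖, fun x _ hx f hf => ?_⟩
  obtain ⟨hfx, hfn⟩ := hf
  have hfn' : ‖f‖ = ‖(x : X)‖ := (sq_eq_sq₀ (norm_nonneg _) (norm_nonneg _)).1 hfn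
  have hl := (Complex.continuous_re.tendsto _).comp ((f.continuous.tendsto _).comp (hlim x))
  have hr := ((hlim ⟨0, h0⟩).norm).mul_const (1 - ‖(x : X)‖ ^ 2)
  have key := le_of_tendsto_of_tendsto hl hr (by
    filter_upwards [hev] with α hα
    have hα' : 0 ≤ α⁻¹ := (inv_pos.2 hα.1).le
    have h1 := norm_sub_norm_le_of_mapsTo_unitBall (hd α hα.1 hα.2)
      ((hA α hα.1 hα.2).2.1.mono_right hDB) hx
    have h2 : (f (Φ α x)).re ≤ ‖(x : X)‖ * ‖Φ α x‖ :=
      (Complex.re_le_norm _).trans (hfn' ▸ f.le_opNorm _)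
    -- Schwarz–Pick is multiplied by `‖x‖ < 1`; that factor can be dropped on the right, which is
    -- nonnegative.
    have h3 : (f (Φ α x)).re - ‖(x : X)‖ ^ 2 ≤ ‖Φ α 0‖ * (1 - ‖(x : X)‖ ^ 2) := by
      have h4 : 0 ≤ ‖Φ α 0‖ * (1 - ‖(x : X)‖ ^ 2) :=
        mul_nonneg (norm_nonneg _) (by nlinarith [norm_nonneg (x : X)])
      nlinarith [mul_le_mul_of_nonneg_left h1 (norm_nonneg (x : X)), norm_nonneg (x : X)]
    simp only [Function.comp_apply, map_smul, map_sub, hfx, smul_eq_mul, Complex.re_ofReal_mul,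
      Complex.sub_re, Complex.ofReal_re, sub_zero, norm_smul, Complex.norm_real,
      Real.norm_of_nonneg hα']
    rw [mul_assoc]
    exact mul_le_mul_of_nonneg_left h3 hα')
  simp only [map_sub, map_smul, hfx, smul_eq_mul, Complex.re_ofReal_mul, Complex.sub_re,
    Complex.ofReal_re, smul_zero, sub_zero] at key
  linarith

end

end AbelAverage

theorem theorem1 {X : Type*} [NormedAddCommGroup X] [NormedSpace ℂ X] [CompleteSpace X]
    (D : Set X) (hDB : D ⊆ ball (0 : X) 1) (hDdense : ball (0 : X) 1 ⊆ closure D)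
    (hDbal : Balanced ℂ D) (ω : ℝ) (h : D → X)
    (hpc : AbelAverage.IsPseudoContractive ω h)
    (hclosed : AbelAverage.IsWeaklyClosedMap h)
    (hX : AbelAverage.IsReflexiveSpace X ∨
      (AbelAverage.IsWeaklySeqComplete X ∧ AbelAverage.IsBoundedOnDiscs h)) :
    AbelAverage.IsDissipative ω h := by
  obtain ⟨d, hd⟩ := closure_nonempty_iff.1 ⟨0, hDdense (mem_ball_self one_pos)⟩
  exact hpc.isDissipative hDB hDdense (hDbal.zero_mem ⟨d, hd⟩)
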